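/- Let $\mathbb K$ be a field of characteristic $0$ (for instance $\mathbb Q$, $\mathbb R$ or $\mathbb C$). For $r\in\mathbb Z$ let $\mathcal F_r$ be the space of formal power series $\varphi(x)\in\mathbb K[[x]]$ satisfying $\varphi\big(x/(x-1)\big)=(1-x)^r\varphi(x)$. Let $B_n$ be the Bernoulli numbers, $\frac{t}{e^t-1}=\sum_n B_n\frac{t^n}{n!}$, let $E_n(x)$ be the Euler polynomials, $\frac{2e^{xt}}{e^t+1}=\sum_n E_n(x)\frac{t^n}{n!}$, and let ${m\brace i}$ denote the coefficient of $x^{2i}$ in $x^{2m+1}-E_{2m+1}(x)$. For integers $0\le i\le m$ put $$C_m=1\cdot3\cdot5\cdots(2m+1),\qquad G_i^m=2\cdot1\cdot3\cdot5\cdots(2m-1)\binom{2m+1}{2i+1}B_{2m-2i},$$ and let $A_i^m$ be defined recursively by $A_i^i=(2i+1)2^{\lfloor (i+1)/2\rfloor}$ and $$2^{-\lfloor (k+2)/2\rfloor}A_i^{k+1}=\binom{2k+3}{2i}-\sum_{j=i}^k\binom{2k+3}{2j+1}2^{-\lfloor (j+3)/2\rfloor}A_i^j,\qquad 0\le i\le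 k.$$ For all integers $m,i\ge0$ put $Q_i^m=\binom mi+2\binom m{i-1}$, where $\binom m{-1}=0$. **(1)** Let $f_n(k)\in\mathbb K$, $0\le k\le n$, be a triangular array with $f_n(k)=f_n(n-k)$. For $n\ge1$ and $p\ge0$ let $S_{n,p}=n^{-p}\sum_{k=0}^n k^pf_n(k)$ (with $0^0=1$). Then for every $n\ge1$ the generating function $\varphi_n(x)=\sum_{p\ge0}S_{n,p}x^p$ lies in $\mathcal F_1$, and the following identities hold. (a) For all $m\ge1$, $$\sum_{i=0}^m(-1)^i\binom{2m-1}{m-i}\binom{m+i}{i}S_{n,m+i-1}=0$$ and (Gould's Eq. (5)) $$\sum_{i=0}^m(-1)^iQ_i^{m-1}n^{m-i}\sum_{k=0}^nk^{m+i-1}f_n(k)=0.$$ (b) For all $m\ge0$, $$S_{n,2m+1}=\sum_{i=0}^m{m\brace i}S_{n,2i}$$ and (Gould's Eq. (15)) $$2^{\lfloor (m+3)/2\rfloor}S_{n,2m+1}=\sum_{i=0}^mA_i^mS_{n,2i}.$$ (c) For all $m\ge0$, $$S_{n,2m}=\frac{2}{2m+1}\sum_{i=0}^m\binom{2m+1}{2i+1}B_{2m-2i}S_{n,2i+1}$$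 and (Gould's Eq. (29)) $$C_mS_{n,2m}=\sum_{i=0}^mG_i^mS_{n,2i+1}.$$ **(2)** The first identity in each of (a), (b), (c) is an instance of a characterization of $\mathcal F_1$: for every $\varphi(x)=\sum_{i\ge0}\gamma_ix^i\in\mathbb K[[x]]$, the condition $\varphi\in\mathcal F_1$ is equivalent to each one of the following three conditions: - $\sum_{i=0}^m(-1)^i\binom{2m-1}{m-i}\binom{m+i}{i}\gamma_{m+i-1}=0$ for all $m\ge1$; - $\gamma_{2m+1}=\sum_{i=0}^m{m\brace i}\gamma_{2i}$ for all $m\ge0$; - $\gamma_{2m}=\frac{2}{2m+1}\sum_{i=0}^m\binom{2m+1}{2i+1}B_{2m-2i}\gamma_{2i+1}$ for all $m\ge0$. **(3)** The two identities in each of (a), (b), (c) agree up to a constant factor: $$\binom{2m-1}{m-i}\binom{m+i}{i}=\frac{(2m-1)!}{m!\,(m-1)!}\,Q_i^{m-1}\quad(m\ge1,\ 0\le i\le m),$$ $$A_i^m=2^{\lfloor (m+3)/2\rfloor}{m\brace i},\qquad G_i^m=C_m\cdot\frac{2}{2m+1}\binom{2m+1}{2i+1}B_{2m-2i}\quad(0\le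 i\le m).$$ -/

import Mathlib

open scoped PowerSeries

namespace PowerSums

noncomputable section

/-- The unit `1 - x` of the ring `K⟦x⟧`. -/
def oneSubX (K : Type*) [Field K] : K⟦X⟧ˣ where
  val := 1 - PowerSeries.X
  inv := (1 - PowerSeries.X)⁻¹
  val_inv := PowerSeries.mul_inv_cancel _ (by simp)
  inv_val := PowerSeries.inv_mul_cancel _ (by simp)

/-- The power series `x / (x - 1)`. -/
def moebius (K : Type*) [Field K] : K⟦X⟧ :=
  PowerSeries.X * (PowerSeries.X - 1)⁻¹

theorem hasSubst_moebius (K : Type*) [Field K] : PowerSeries.HasSubst (moebius K) :=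
  PowerSeries.HasSubst.of_constantCoeff_zero' (by simp [moebius])

/-- The space `F_r` of all formal power series `φ` over `K` with
`φ (x / (x - 1)) = (1 - x) ^ r * φ x`, for an integer `r`. -/
def F (K : Type*) [Field K] (r : ℤ) : Submodule K K⟦X⟧ where
  carrier := {φ | φ.subst (moebius K) = ((oneSubX K ^ r : K⟦X⟧ˣ) : K⟦X⟧) * φ}
  add_mem' {a b} ha hb := by
    simp only [Set.mem_ofPred_eq] at ha hb ⊢
    rw [PowerSeries.subst_add (hasSubst_moebius K), ha, hb, mul_add]
  zero_mem' := by
    simp only [Set.mem_ofPred_eq, mul_zero]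
    rw [← PowerSeries.coe_substAlgHom (hasSubst_moebius K), map_zero]
  smul_mem' c a ha := by
    simp only [Set.mem_ofPred_eq] at ha ⊢
    rw [PowerSeries.subst_smul (hasSubst_moebius K), ha, mul_smul_comm]

/-- The Euler polynomial `E_n(x)`, defined by
`2 e ^ (x t) / (e ^ t + 1) = ∑ E_n(x) t ^ n / n!`, an identity in `ℚ[x]⟦t⟧`. -/
def eulerPoly (n : ℕ) : Polynomial ℚ :=
  (n.factorial : Polynomial ℚ) *
    PowerSeries.coeff n
      (PowerSeries.map Polynomial.C (2 * (PowerSeries.exp ℚ + 1)⁻¹) *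
        PowerSeries.rescale Polynomial.X (PowerSeries.exp (Polynomial ℚ)))

/-- The number `{n, i}`: the coefficient of `x ^ (2 i)` in `x ^ (2 n + 1) - E_{2 n + 1}(x)`. -/
def eulerBrace (n i : ℕ) : ℚ :=
  (Polynomial.X ^ (2 * n + 1) - eulerPoly (2 * n + 1)).coeff (2 * i)

/-- `S_{n,p} = n ^ (-p) * ∑_{k=0}^n k ^ p f_n(k)`, for `n ≥ 1`, where `0 ^ 0 = 1`. -/
def powerSum {K : Type*} [Field K] (f : ℕ → ℕ → K) (n p : ℕ) : K :=
  ((n : K) ^ p)⁻¹ * ∑ k ∈ Finset.range (n + 1), (k : K) ^ p * f n k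

/-- The generating function `φ_n(x) = ∑_p S_{n,p} x ^ p`. -/
def powerSumSeries {K : Type*} [Field K] (f : ℕ → ℕ → K) (n : ℕ) : K⟦X⟧ :=
  PowerSeries.mk (powerSum f n)

/-- `Q_i^m = binom(m, i) + 2 binom(m, i - 1)`, where `binom(m, -1) = 0`. -/
def gouldQ (m i : ℕ) : ℚ :=
  (m.choose i : ℚ) + 2 * (if i = 0 then 0 else (m.choose (i - 1) : ℚ))

/-- Gould's numbers `A_i^m` for `0 ≤ i ≤ m` (set to be zero for `i > m`), defined by recursion on
`m`; see `gouldA_self` and `gouldA_succ`. -/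
def gouldA (m i : ℕ) : ℚ :=
  if m < i then 0
  else if m = i then (2 * i + 1) * 2 ^ ((i + 1) / 2)
  else 2 ^ ((m + 1) / 2) * (((2 * m + 1).choose (2 * i) : ℚ) -
    ∑ j ∈ (Finset.Ico i m).attach,
      ((2 * m + 1).choose (2 * (j : ℕ) + 1) : ℚ) * (2 ^ (((j : ℕ) + 3) / 2))⁻¹ * gouldA j i)
termination_by m
decreasing_by exact (Finset.mem_Ico.mp j.2).2

theorem gouldA_self (i : ℕ) : gouldA i i = (2 * i + 1) * 2 ^ ((i + 1) / 2) := by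
  rw [gouldA]
  simp

theorem gouldA_succ (k i : ℕ) (h : i ≤ k) :
    (2 ^ ((k + 2) / 2))⁻¹ * gouldA (k + 1) i =
      ((2 * k + 3).choose (2 * i) : ℚ) -
        ∑ j ∈ Finset.Icc i k,
          ((2 * k + 3).choose (2 * j + 1) : ℚ) * (2 ^ ((j + 3) / 2))⁻¹ * gouldA j i := by
  rw [gouldA, if_neg (by omega), if_neg (by omega),
    Finset.sum_attach (Finset.Ico i (k + 1)) (fun j =>
      ((2 * (k + 1) + 1).choose (2 * j + 1) : ℚ) * (2 ^ ((j + 3) / 2))⁻¹ * gouldA j i),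
    show Finset.Ico i (k + 1) = Finset.Icc i k by ext; simp,
    ← mul_assoc, inv_mul_cancel₀ (by positivity), one_mul]
  rfl

/-- `C_m = 1 · 3 · 5 ⋯ (2 m + 1)`. -/
def gouldC (m : ℕ) : ℚ :=
  ∏ j ∈ Finset.range (m + 1), (2 * (j : ℚ) + 1)

/-- `G_i^m = 2 · 1 · 3 · 5 ⋯ (2 m - 1) · binom(2 m + 1, 2 i + 1) · B_{2 m - 2 i}`,
for `0 ≤ i ≤ m`. -/
def gouldG (m i : ℕ) : ℚ :=
  2 * (∏ j ∈ Finset.range m, (2 * (j : ℚ) + 1)) *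
    ((2 * m + 1).choose (2 * i + 1) : ℚ) * bernoulli (2 * m - 2 * i)

end

end PowerSums

/-! Encode `φ = ∑ γ_i x^i` by the linear functional `L` on `K[X]` with `L(X^n) = γ_n`. Since
`(1-x)⁻¹ (x/(x-1))^k = (-1)^k ∑ binom(n,k) x^n`, the `n`-th coefficient of `(1-x)⁻¹ φ(x/(x-1))` is
`L((1-X)^n)`. Hence `φ ∈ F_1` exactly when `L` is invariant under `X ↦ 1-X`, that is (characteristic
0), when `L` kills every antisymmetric `p`, `p(1-X) = -p`.

A nonzero antisymmetric polynomial has odd degree, so any antisymmetric `P_0, P_1, ...` with `deg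
P_m = 2m+1` span them all, and `L(P_m) = 0` for all `m` characterizes `F_1`
(`mem_F_one_iff_of_rat_family`). The three characterizations come from `X^m (1-X)^m (1-2X)`, the
Euler polynomials `E_{2m+1}` and the Bernoulli polynomials `B_{2m+1}`.

For a power sum series, `L(p) = ∑ p(k/n) f_n(k)`, and the symmetry of `f_n` is exactly the
invariance of `L`. Gould's forms then follow by rescaling; only `A_i^m` needs an induction, matching
its recursion with one for Euler numbers (`gouldA_eq`). -/

namespace PowerSums

/-! ### `F_1` as invariance of a functional under `X ↦ 1-X` -/

section Functional

variable {K : Type*} [Field K]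

/-- The linear functional on polynomials which sends `X ^ n` to the `n`-th coefficient of `φ`. -/
noncomputable def coeffFunctional (φ : K⟦X⟧) : Polynomial K →ₗ[K] K :=
  (Polynomial.basisMonomials K).constr K fun n => PowerSeries.coeff n φ

theorem coeffFunctional_X_pow (φ : K⟦X⟧) (n : ℕ) :
    coeffFunctional φ (Polynomial.X ^ n) = PowerSeries.coeff n φ := by
  have h := (Polynomial.basisMonomials K).constr_basis K (fun n => PowerSeries.coeff n φ) n
  simp only [Polynomial.coe_basisMonomials, Polynomial.monomial_one_right_eq_X_pow] at h
  exact h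

theorem coeffFunctional_C_mul (φ : K⟦X⟧) (a : K) (p : Polynomial K) :
    coeffFunctional φ (Polynomial.C a * p) = a * coeffFunctional φ p := by
  rw [← Polynomial.smul_eq_C_mul, map_smul, smul_eq_mul]

theorem coeffFunctional_map [CharZero K] (φ : K⟦X⟧) (p : Polynomial ℚ) {N : ℕ}
    (hN : p.natDegree < N) :
    coeffFunctional φ (p.map (algebraMap ℚ K)) =
      ∑ j ∈ Finset.range N, (p.coeff j : K) * PowerSeries.coeff j φ := by
  conv_lhs => rw [p.as_sum_range' N hN]
  simp [Polynomial.map_sum, ← Polynomial.C_mul_X_pow_eq_monomial, coeffFunctional_C_mul,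
    coeffFunctional_X_pow]

theorem linearMap_ext_X_pow {f g : Polynomial K →ₗ[K] K}
    (h : ∀ n, f (Polynomial.X ^ n) = g (Polynomial.X ^ n)) : f = g := by
  refine (Polynomial.basisMonomials K).ext fun n => ?_
  simpa only [Polynomial.coe_basisMonomials, Polynomial.monomial_one_right_eq_X_pow] using h n

theorem coeffFunctional_one_sub_X_pow (φ : K⟦X⟧) (n : ℕ) :
    coeffFunctional φ ((1 - Polynomial.X) ^ n) =
      ∑ k ∈ Finset.range (n + 1), (-1) ^ k * (n.choose k : K) * PowerSeries.coeff k φ := by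
  rw [sub_eq_neg_add, add_pow, map_sum]
  refine Finset.sum_congr rfl fun k _ => ?_
  rw [← coeffFunctional_X_pow, ← coeffFunctional_C_mul]
  congr 1
  rw [neg_pow]
  simp
  ring

/-- With `x/(x-1) = -x(1-x)⁻¹`, the left side is `(-x)^k (1-x)^{-(k+1)}`, a negative binomial
series. -/
theorem mk_one_mul_moebius_pow (k : ℕ) :
    (PowerSeries.mk 1 : K⟦X⟧) * moebius K ^ k =
      PowerSeries.C ((-1) ^ k) * (PowerSeries.X ^ k * PowerSeries.mk fun n => ((k + n).choose k : K)) := by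
  have h : moebius K = -(PowerSeries.X * PowerSeries.mk 1) := by
    rw [moebius, ← mul_neg]
    congr 1
    rw [PowerSeries.inv_eq_iff_mul_eq_one (by simp)]
    linear_combination PowerSeries.mk_one_mul_one_sub_eq_one K
  rw [h, ← PowerSeries.mk_one_pow_eq_mk_choose_add, neg_pow, mul_pow, pow_succ]
  simp
  ring

theorem coeff_mk_one_mul_moebius_pow (n k : ℕ) :
    PowerSeries.coeff n ((PowerSeries.mk 1 : K⟦X⟧) * moebius K ^ k) = (-1) ^ k * (n.choose k : K) := by
  rw [mk_one_mul_moebius_pow, PowerSeries.coeff_C_mul, PowerSeries.coeff_X_pow_mul']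
  split_ifs with h
  · simp [Nat.add_sub_cancel' h]
  · simp [Nat.choose_eq_zero_of_lt (not_le.mp h)]

/-- `moebius K ^ k` is divisible by `X ^ k`, so only `k ≤ j` contribute. The bound `n`, independent
of `j`, allows the later exchange of sums. -/
theorem coeff_subst_moebius (φ : K⟦X⟧) {j n : ℕ} (hj : j ≤ n) :
    PowerSeries.coeff j (φ.subst (moebius K)) =
      ∑ k ∈ Finset.range (n + 1), PowerSeries.coeff k φ * PowerSeries.coeff j (moebius K ^ k) := by
  rw [PowerSeries.coeff_subst' (hasSubst_moebius K), finsum_eq_sum_of_support_subset (s := Finset.range (n + 1))]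
  · simp
  · intro k hk
    by_contra hkn
    apply hk
    simp only [Finset.coe_range, Set.mem_Iio, not_lt] at hkn
    beta_reduce
    rw [moebius, mul_pow, PowerSeries.coeff_X_pow_mul', if_neg (by omega), smul_zero]

theorem coeff_mk_one_mul_subst_moebius (φ : K⟦X⟧) (n : ℕ) :
    PowerSeries.coeff n (PowerSeries.mk 1 * φ.subst (moebius K)) =
      coeffFunctional φ ((1 - Polynomial.X) ^ n) := by
  rw [coeffFunctional_one_sub_X_pow, PowerSeries.coeff_mul]
  calc _ = ∑ p ∈ Finset.HasAntidiagonal.antidiagonal n, ∑ k ∈ Finset.range (n + 1),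
        PowerSeries.coeff k φ * (PowerSeries.coeff p.1 (PowerSeries.mk 1 : K⟦X⟧) *
          PowerSeries.coeff p.2 (moebius K ^ k)) := by
        refine Finset.sum_congr rfl fun p hp => ?_
        rw [coeff_subst_moebius φ (Finset.HasAntidiagonal.antidiagonal.snd_le hp), Finset.mul_sum]
        exact Finset.sum_congr rfl fun k _ => by ring
    _ = _ := by
        rw [Finset.sum_comm]
        refine Finset.sum_congr rfl fun k _ => ?_
        rw [← Finset.mul_sum, ← PowerSeries.coeff_mul, coeff_mk_one_mul_moebius_pow]
        ring

theorem mem_F_one_iff (φ : K⟦X⟧) :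
    φ ∈ F K 1 ↔ PowerSeries.mk 1 * φ.subst (moebius K) = φ := by
  have h1 : ((oneSubX K ^ (1 : ℤ) : K⟦X⟧ˣ) : K⟦X⟧) = 1 - PowerSeries.X := by
    rw [zpow_one]; rfl
  have h2 := PowerSeries.mk_one_mul_one_sub_eq_one K
  change φ.subst (moebius K) = ((oneSubX K ^ (1 : ℤ) : K⟦X⟧ˣ) : K⟦X⟧) * φ ↔ _
  rw [h1]
  constructor
  · intro h
    rw [h, ← mul_assoc, h2, one_mul]
  · intro h
    conv_rhs => rw [← h]
    rw [← mul_assoc, mul_comm (1 - PowerSeries.X), h2, one_mul]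

theorem mem_F_one_iff_comp (φ : K⟦X⟧) :
    φ ∈ F K 1 ↔ ∀ p : Polynomial K,
      coeffFunctional φ (p.comp (1 - Polynomial.X)) = coeffFunctional φ p := by
  rw [mem_F_one_iff, PowerSeries.ext_iff]
  simp only [coeff_mk_one_mul_subst_moebius]
  constructor
  · intro h p
    have : coeffFunctional φ ∘ₗ (Polynomial.aeval (1 - Polynomial.X)).toLinearMap = coeffFunctional φ :=
      linearMap_ext_X_pow fun n => by simpa [coeffFunctional_X_pow] using h n
    rw [Polynomial.comp_eq_aeval]
    exact LinearMap.congr_fun this p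
  · intro h n
    simpa [coeffFunctional_X_pow] using h (Polynomial.X ^ n)

variable [CharZero K]

theorem mem_F_one_iff_antisymm (φ : K⟦X⟧) :
    φ ∈ F K 1 ↔ ∀ p : Polynomial K, p.comp (1 - Polynomial.X) = -p →
      coeffFunctional φ p = 0 := by
  rw [mem_F_one_iff_comp]
  constructor
  · intro h p hp
    have := h p
    rw [hp, map_neg] at this
    exact self_eq_neg.mp this.symm
  · intro h p
    rw [← sub_eq_zero, ← map_sub]
    apply h
    -- The difference `p(1-X) - p` is antisymmetric because `X ↦ 1-X` is an involution.
    rw [Polynomial.sub_comp, Polynomial.comp_assoc]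
    simp

/-- Substituting `1-X` multiplies the leading coefficient by `(-1)^deg`, which must equal `-1`. -/
theorem odd_natDegree_of_antisymm {p : Polynomial K} (hp : p.comp (1 - Polynomial.X) = -p)
    (h0 : p ≠ 0) : Odd p.natDegree := by
  have hX : (1 - Polynomial.X : Polynomial K) = -(Polynomial.X - Polynomial.C 1) := by simp
  have hd : (1 - Polynomial.X : Polynomial K).natDegree = 1 := by
    rw [hX, Polynomial.natDegree_neg, Polynomial.natDegree_X_sub_C]
  have h := congrArg Polynomial.leadingCoeff hp
  rw [Polynomial.leadingCoeff_comp (by rw [hd]; exact one_ne_zero), hX, Polynomial.leadingCoeff_neg,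
    Polynomial.leadingCoeff_X_sub_C, Polynomial.leadingCoeff_neg] at h
  by_contra hodd
  rw [Nat.not_odd_iff_even] at hodd
  rw [hodd.neg_one_pow, mul_one] at h
  exact h0 (Polynomial.leadingCoeff_eq_zero.mp (self_eq_neg.mp h))

/-- Strong induction on the degree: subtracting a multiple of the `P m` of equal degree cancels the
leading term and preserves antisymmetry. -/
theorem antisymm_mem_span {P : ℕ → Polynomial K}
    (hP : ∀ m, (P m).comp (1 - Polynomial.X) = -P m) (hd : ∀ m, (P m).natDegree = 2 * m + 1)
    {p : Polynomial K} (hp : p.comp (1 - Polynomial.X) = -p) :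
    p ∈ Submodule.span K (Set.range P) := by
  induction hn : p.natDegree using Nat.strong_induction_on generalizing p with
  | _ n ih =>
    by_cases h0 : p = 0
    · rw [h0]; exact Submodule.zero_mem _
    obtain ⟨m, hm⟩ := odd_natDegree_of_antisymm hp h0
    have hPm : P m ≠ 0 := fun h => by simpa [h] using hd m
    have hPl : (P m).leadingCoeff ≠ 0 := Polynomial.leadingCoeff_ne_zero.mpr hPm
    set c := p.leadingCoeff / (P m).leadingCoeff with hc
    have hc0 : c ≠ 0 := div_ne_zero (Polynomial.leadingCoeff_ne_zero.mpr h0) hPl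
    have hspan : c • P m ∈ Submodule.span K (Set.range P) :=
      Submodule.smul_mem _ _ (Submodule.subset_span ⟨m, rfl⟩)
    rw [← sub_add_cancel p (c • P m)]
    refine Submodule.add_mem _ ?_ hspan
    have hlt : (p - c • P m).natDegree < n := by
      have hcd : (c • P m).natDegree = p.natDegree := by
        rw [Polynomial.natDegree_smul _ hc0, hd, hm]
      rw [← hn]
      refine lt_of_le_of_ne ?_ fun heq => ?_
      · exact (Polynomial.natDegree_sub_le _ _).trans (by rw [hcd, max_self])
      · have : (p - c • P m).leadingCoeff = 0 := by
          rw [Polynomial.leadingCoeff, heq, Polynomial.coeff_sub, Polynomial.coeff_smul, smul_eq_mul]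
          have e : (P m).coeff p.natDegree = (P m).leadingCoeff := by
            rw [Polynomial.leadingCoeff, hd, hm]
          rw [e, hc, div_mul_cancel₀ _ hPl, Polynomial.leadingCoeff, sub_self]
        -- Without a drop in degree the difference would be zero, of degree 0, whereas `p` has odd
        -- degree.
        rw [Polynomial.leadingCoeff_eq_zero.mp this, Polynomial.natDegree_zero] at heq
        omega
    refine ih _ hlt ?_ rfl
    rw [Polynomial.sub_comp, Polynomial.smul_comp, hp, hP]
    module

theorem mem_F_one_iff_of_family (φ : K⟦X⟧) {P : ℕ → Polynomial K}
    (hP : ∀ m, (P m).comp (1 - Polynomial.X) = -P m) (hd : ∀ m, (P m).natDegree = 2 * m + 1) :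
    φ ∈ F K 1 ↔ ∀ m, coeffFunctional φ (P m) = 0 := by
  rw [mem_F_one_iff_antisymm]
  refine ⟨fun h m => h _ (hP m), fun h p hp => ?_⟩
  have hle : Submodule.span K (Set.range P) ≤ LinearMap.ker (coeffFunctional φ) :=
    Submodule.span_le.mpr (by rintro _ ⟨m, rfl⟩; exact h m)
  exact hle (antisymm_mem_span hP hd hp)

theorem mem_F_one_iff_of_rat_family (φ : K⟦X⟧) {P : ℕ → Polynomial ℚ}
    (hP : ∀ m, (P m).comp (1 - Polynomial.X) = -P m) (hd : ∀ m, (P m).natDegree = 2 * m + 1) :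
    φ ∈ F K 1 ↔ ∀ m, coeffFunctional φ ((P m).map (algebraMap ℚ K)) = 0 := by
  refine mem_F_one_iff_of_family φ (fun m => ?_) fun m => ?_
  · have := congrArg (Polynomial.map (algebraMap ℚ K)) (hP m)
    rw [Polynomial.map_comp] at this
    simpa using this
  · rw [Polynomial.natDegree_map, hd]

end Functional

/-! ### Power sums of symmetric arrays -/

section PowerSum

variable {K : Type*} [Field K] [CharZero K]

theorem coeffFunctional_powerSumSeries (f : ℕ → ℕ → K) (n : ℕ) (p : Polynomial K) :
    coeffFunctional (powerSumSeries f n) p =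
      ∑ k ∈ Finset.range (n + 1), p.eval ((k : K) / n) * f n k := by
  have : coeffFunctional (powerSumSeries f n) =
      ∑ k ∈ Finset.range (n + 1), f n k • Polynomial.leval ((k : K) / n) := by
    refine linearMap_ext_X_pow fun q => ?_
    simp only [coeffFunctional_X_pow, powerSumSeries, PowerSeries.coeff_mk, powerSum,
      LinearMap.sum_apply, LinearMap.smul_apply, Polynomial.leval_apply, Polynomial.eval_pow,
      Polynomial.eval_X, smul_eq_mul, Finset.mul_sum, div_pow]
    exact Finset.sum_congr rfl fun k _ => by ring
  rw [this]
  simp [mul_comm]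

theorem powerSumSeries_mem_F_one {f : ℕ → ℕ → K}
    (hf : ∀ n k : ℕ, k ≤ n → f n k = f n (n - k)) {n : ℕ} (hn : 1 ≤ n) :
    powerSumSeries f n ∈ F K 1 := by
  rw [mem_F_one_iff_comp]
  intro p
  have hn0 : (n : K) ≠ 0 := Nat.cast_ne_zero.mpr (by omega)
  -- Reflecting `k ↦ n - k` fixes `f n k` and turns `k/n` into `1 - k/n`.
  rw [coeffFunctional_powerSumSeries, coeffFunctional_powerSumSeries, ← Finset.sum_range_reflect]
  refine Finset.sum_congr rfl fun k hk => ?_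
  have hk' : k ≤ n := Nat.lt_succ_iff.mp (Finset.mem_range.mp hk)
  rw [show n + 1 - 1 - k = n - k by omega, ← hf n k hk', Polynomial.eval_comp, Nat.cast_sub hk']
  congr 2
  simp
  field_simp
  ring

end PowerSum

/-! ### Euler numbers, Euler polynomials and Gould's `A_i^m` -/

section Euler

theorem sum_range_two_mul {M : Type*} [AddCommMonoid M] (a : ℕ → M) (m : ℕ) :
    ∑ j ∈ Finset.range (2 * m), a j =
      ∑ i ∈ Finset.range m, (a (2 * i) + a (2 * i + 1)) := by
  induction m with
  | zero => simp
  | succ m ih =>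
    rw [Finset.sum_range_succ, ← ih, show 2 * (m + 1) = 2 * m + 1 + 1 by ring,
      Finset.sum_range_succ, Finset.sum_range_succ, add_assoc]

/-- The power series `2 / (e ^ t + 1)`. -/
noncomputable def eulerGen : ℚ⟦X⟧ := 2 * (PowerSeries.exp ℚ + 1)⁻¹

theorem eulerGen_mul : eulerGen * (PowerSeries.exp ℚ + 1) = 2 := by
  rw [eulerGen, mul_assoc, PowerSeries.inv_mul_cancel _ (by simp), mul_one]

theorem evalNegHom_eulerGen :
    PowerSeries.evalNegHom eulerGen = eulerGen * PowerSeries.exp ℚ := by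
  have h := congrArg PowerSeries.evalNegHom eulerGen_mul
  have he := PowerSeries.exp_mul_exp_neg_eq_one (A := ℚ)
  rw [map_mul, map_add, map_one, map_ofNat] at h
  have hne : PowerSeries.exp ℚ + 1 ≠ 0 := fun h0 => by
    simpa using congrArg PowerSeries.constantCoeff h0
  apply mul_right_cancel₀ hne
  linear_combination (PowerSeries.exp ℚ) * h - (PowerSeries.exp ℚ) * eulerGen_mul -
    (PowerSeries.evalNegHom eulerGen) * he

/-- Says that `2/(e^t+1) - 1` is odd, which makes the Euler numbers of positive even index vanish.
-/
theorem evalNegHom_eulerGen_add : PowerSeries.evalNegHom eulerGen + eulerGen = 2 := by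
  rw [evalNegHom_eulerGen, ← eulerGen_mul, mul_add, mul_one]

/-- The value `E_n(0)` of the Euler polynomial. -/
noncomputable def eulerNum (n : ℕ) : ℚ := n.factorial * PowerSeries.coeff n eulerGen

theorem eulerNum_zero : eulerNum 0 = 1 := by
  have h := congrArg (PowerSeries.coeff 0) evalNegHom_eulerGen_add
  rw [PowerSeries.evalNegHom, map_add, PowerSeries.coeff_rescale,
    show (2 : ℚ⟦X⟧) = PowerSeries.C 2 from rfl, PowerSeries.coeff_zero_C] at h
  simp only [pow_zero, one_mul] at h
  rw [eulerNum, Nat.factorial_zero, Nat.cast_one, one_mul]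
  linarith

theorem eulerNum_two_mul {n : ℕ} (hn : n ≠ 0) : eulerNum (2 * n) = 0 := by
  have h := congrArg (PowerSeries.coeff (2 * n)) evalNegHom_eulerGen_add
  rw [PowerSeries.evalNegHom, map_add, PowerSeries.coeff_rescale,
    show (2 : ℚ⟦X⟧) = PowerSeries.C 2 from rfl, PowerSeries.coeff_C, if_neg (by omega),
    (even_two_mul n).neg_one_pow] at h
  rw [eulerNum, show PowerSeries.coeff (2 * n) eulerGen = 0 by linarith, mul_zero]

theorem sum_choose_mul_eulerNum {n : ℕ} (hn : n ≠ 0) :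
    ∑ l ∈ Finset.range (n + 1), (n.choose l : ℚ) * eulerNum l + eulerNum n = 0 := by
  have h := congrArg (PowerSeries.coeff n) eulerGen_mul
  rw [mul_add, mul_one, map_add, PowerSeries.coeff_mul,
    show (2 : ℚ⟦X⟧) = PowerSeries.C 2 from rfl, PowerSeries.coeff_C, if_neg hn,
    Finset.Nat.sum_antidiagonal_eq_sum_range_succ_mk] at h
  have h' := congrArg ((n.factorial : ℚ) * ·) h
  simp only [mul_add, mul_zero, Finset.mul_sum] at h'
  rw [← h', eulerNum]
  congr 1
  refine Finset.sum_congr rfl fun l hl => ?_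
  have hl' : l ≤ n := Nat.lt_succ_iff.mp (Finset.mem_range.mp hl)
  rw [PowerSeries.coeff_exp, eulerNum, Nat.cast_choose ℚ hl']
  have := Nat.cast_ne_zero (R := ℚ).mpr (Nat.factorial_ne_zero l)
  have := Nat.cast_ne_zero (R := ℚ).mpr (Nat.factorial_ne_zero (n - l))
  simp
  field_simp

theorem eulerNum_one : eulerNum 1 = -1 / 2 := by
  have h := sum_choose_mul_eulerNum one_ne_zero
  simp [Finset.sum_range_succ, eulerNum_zero] at h
  linarith

theorem coeff_eulerPoly (n j : ℕ) :
    (eulerPoly n).coeff j = if j ≤ n then (n.choose j : ℚ) * eulerNum (n - j) else 0 := by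
  rw [eulerPoly, PowerSeries.coeff_mul, ← Polynomial.C_eq_natCast, Polynomial.coeff_C_mul,
    Polynomial.finsetSum_coeff, Finset.Nat.sum_antidiagonal_eq_sum_range_succ_mk]
  have hterm : ∀ k, (PowerSeries.coeff k (PowerSeries.map Polynomial.C
      (2 * (PowerSeries.exp ℚ + 1)⁻¹)) * PowerSeries.coeff (n - k)
      (PowerSeries.rescale Polynomial.X (PowerSeries.exp (Polynomial ℚ)))).coeff j =
      if j = n - k then PowerSeries.coeff k eulerGen * (1 / ((n - k).factorial : ℚ)) else 0 := by
    intro k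
    rw [PowerSeries.coeff_map, PowerSeries.coeff_rescale, PowerSeries.coeff_exp,
      Polynomial.coeff_C_mul, show algebraMap ℚ (Polynomial ℚ) = Polynomial.C from rfl,
      Polynomial.coeff_mul_C, Polynomial.coeff_X_pow, ite_mul, one_mul, zero_mul, mul_ite,
      mul_zero]
    rfl
  simp only [hterm]
  split_ifs with h
  · rw [Finset.sum_eq_single_of_mem (n - j) (by simp), if_pos (by omega), eulerNum,
      Nat.cast_choose ℚ h, Nat.sub_sub_self h]
    · have := Nat.cast_ne_zero (R := ℚ).mpr (Nat.factorial_ne_zero j)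
      have := Nat.cast_ne_zero (R := ℚ).mpr (Nat.factorial_ne_zero (n - j))
      field_simp
    · intro k hk hkj
      rw [if_neg]
      have := Finset.mem_range.mp hk
      omega
  · rw [Finset.sum_eq_zero, mul_zero]
    intro k hk
    rw [if_neg (by omega)]

theorem natDegree_eulerPoly (n : ℕ) : (eulerPoly n).natDegree = n := by
  refine Polynomial.natDegree_eq_of_le_of_coeff_ne_zero ?_ (n := n) ?_
  · rw [Polynomial.natDegree_le_iff_coeff_eq_zero]
    intro j hj
    rw [coeff_eulerPoly, if_neg (by omega)]
  · rw [coeff_eulerPoly]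
    simp [eulerNum_zero]

/-- A ring map fixing constants affects `2e^{pt}/(e^t+1)` only through `p`. -/
theorem map_C_eulerGen_mul_rescale (f : Polynomial ℚ →+* Polynomial ℚ)
    (hf : ∀ a, f (Polynomial.C a) = Polynomial.C a) (p : Polynomial ℚ) :
    PowerSeries.map f (PowerSeries.map Polynomial.C eulerGen *
      PowerSeries.rescale p (PowerSeries.exp (Polynomial ℚ))) =
    PowerSeries.map Polynomial.C eulerGen *
      PowerSeries.rescale (f p) (PowerSeries.exp (Polynomial ℚ)) := by
  rw [map_mul]
  congr 1
  · ext1 n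
    simp [hf]
  · ext1 n
    simp only [PowerSeries.coeff_map, PowerSeries.coeff_rescale, map_mul, map_pow,
      PowerSeries.coeff_exp]
    rw [show algebraMap ℚ (Polynomial ℚ) = Polynomial.C from rfl, hf]

/-- Replacing `t` by `-t` in `2e^{Xt}/(e^t+1)` gives `2e^{(1-X)t}/(e^t+1)`. -/
theorem eulerPoly_comp_one_sub_X (n : ℕ) :
    (eulerPoly n).comp (1 - Polynomial.X) = (-1) ^ n * eulerPoly n := by
  have h1 := map_C_eulerGen_mul_rescale (Polynomial.compRingHom (1 - Polynomial.X)) (by simp)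
    Polynomial.X
  have h3 : PowerSeries.rescale (-1) (PowerSeries.map Polynomial.C eulerGen *
      PowerSeries.rescale Polynomial.X (PowerSeries.exp (Polynomial ℚ))) =
      PowerSeries.map Polynomial.C eulerGen *
        PowerSeries.rescale (1 - Polynomial.X) (PowerSeries.exp (Polynomial ℚ)) := by
    have e1 : PowerSeries.rescale (-1) (PowerSeries.map Polynomial.C eulerGen) =
        PowerSeries.map Polynomial.C eulerGen * PowerSeries.exp (Polynomial ℚ) := by
      have := congrArg (PowerSeries.map (Polynomial.C (R := ℚ))) evalNegHom_eulerGen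
      rw [map_mul, PowerSeries.map_exp, PowerSeries.evalNegHom, ← PowerSeries.rescale_map] at this
      simpa using this
    rw [map_mul, e1, PowerSeries.rescale_rescale, mul_assoc]
    congr 1
    have := PowerSeries.exp_mul_exp_eq_exp_add (1 : Polynomial ℚ) (Polynomial.X * -1)
    rw [PowerSeries.rescale_one, RingHom.id_apply] at this
    rw [this]
    congr 2
    ring
  rw [Polynomial.coe_compRingHom_apply, Polynomial.X_comp, ← h3] at h1
  have h4 := congrArg (PowerSeries.coeff n) h1
  rw [PowerSeries.coeff_map, PowerSeries.coeff_rescale] at h4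
  change (Polynomial.comp _ _) = _ at h4
  rw [eulerPoly, Polynomial.mul_comp, ← eulerGen, h4, Polynomial.natCast_comp]
  ring

theorem eulerBrace_eq (m i : ℕ) (h : i ≤ m) :
    eulerBrace m i = -((2 * m + 1).choose (2 * i) * eulerNum (2 * m + 1 - 2 * i)) := by
  rw [eulerBrace, Polynomial.coeff_sub, Polynomial.coeff_X_pow, if_neg (by omega),
    coeff_eulerPoly, if_pos (by omega), zero_sub]

theorem coeff_eulerPoly_even (m i : ℕ) : (eulerPoly (2 * m + 1)).coeff (2 * i) = -eulerBrace m i := by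
  rw [eulerBrace, Polynomial.coeff_sub, Polynomial.coeff_X_pow, if_neg (by omega)]
  ring

theorem coeff_eulerPoly_odd (m i : ℕ) (h : i ≤ m) :
    (eulerPoly (2 * m + 1)).coeff (2 * i + 1) = if i = m then 1 else 0 := by
  rw [coeff_eulerPoly, if_pos (by omega), show 2 * m + 1 - (2 * i + 1) = 2 * (m - i) by omega]
  split_ifs with hi
  · simp [hi, eulerNum_zero]
  · rw [eulerNum_two_mul (by omega), mul_zero]

theorem two_mul_eulerNum_odd (s : ℕ) :
    2 * eulerNum (2 * s + 3) =
      -1 - ∑ t ∈ Finset.range (s + 1), ((2 * s + 3).choose (2 * t + 1) : ℚ) * eulerNum (2 * t + 1) := by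
  have h := sum_choose_mul_eulerNum (n := 2 * s + 3) (by omega)
  have heven : ∑ t ∈ Finset.range (s + 2), ((2 * s + 3).choose (2 * t) : ℚ) * eulerNum (2 * t) = 1 := by
    rw [Finset.sum_eq_single_of_mem 0 (by simp)]
    · simp [eulerNum_zero]
    · intro t _ ht
      rw [eulerNum_two_mul ht, mul_zero]
  -- The last odd term is `eulerNum (2 * s + 3)` itself; with the extra copy in `h` it accounts for
  -- the factor 2.
  rw [show 2 * s + 3 + 1 = 2 * (s + 2) by ring, sum_range_two_mul, Finset.sum_add_distrib, heven,
    Finset.sum_range_succ, show 2 * (s + 1) + 1 = 2 * s + 3 by ring, Nat.choose_self,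
    Nat.cast_one] at h
  linarith

theorem eulerBrace_self (i : ℕ) : eulerBrace i i = (2 * i + 1) / 2 := by
  rw [eulerBrace_eq i i le_rfl, show 2 * i + 1 - 2 * i = 1 by omega, eulerNum_one]
  simp
  ring

/-- Since `binom(n,j) binom(j,l) = binom(n,l) binom(n-l,j-l)`, the factor `binom(2k+3,2i)` comes
out, leaving the Euler number recursion with `s = k - i`. -/
theorem two_mul_eulerBrace_succ (k i : ℕ) (h : i ≤ k) :
    2 * eulerBrace (k + 1) i = ((2 * k + 3).choose (2 * i) : ℚ) -
      ∑ j ∈ Finset.Icc i k, ((2 * k + 3).choose (2 * j + 1) : ℚ) * eulerBrace j i := by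
  obtain ⟨s, rfl⟩ := Nat.exists_eq_add_of_le h
  have hs := two_mul_eulerNum_odd s
  rw [← Finset.Ico_succ_right_eq_Icc, Finset.sum_Ico_eq_sum_range, eulerBrace_eq _ _ (by omega),
    show 2 * (i + s + 1) + 1 - 2 * i = 2 * s + 3 by omega,
    show 2 * (i + s + 1) + 1 = 2 * (i + s) + 3 by omega, show Order.succ (i + s) - i = s + 1 by simp; omega]
  have : ∀ t ∈ Finset.range (s + 1),
      ((2 * (i + s) + 3).choose (2 * (i + t) + 1) : ℚ) * eulerBrace (i + t) i =
      -((2 * (i + s) + 3).choose (2 * i) : ℚ) *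
        (((2 * s + 3).choose (2 * t + 1) : ℚ) * eulerNum (2 * t + 1)) := by
    intro t ht
    have ht' := Finset.mem_range.mp ht
    have hc := Nat.choose_mul (n := 2 * (i + s) + 3) (k := 2 * (i + t) + 1) (s := 2 * i)
      (by omega)
    rw [show 2 * (i + s) + 3 - 2 * i = 2 * s + 3 by omega,
      show 2 * (i + t) + 1 - 2 * i = 2 * t + 1 by omega] at hc
    have hc' : (((2 * (i + s) + 3).choose (2 * (i + t) + 1) : ℚ) * ((2 * (i + t) + 1).choose (2 * i) : ℚ)
      = ((2 * (i + s) + 3).choose (2 * i) : ℚ) * ((2 * s + 3).choose (2 * t + 1) : ℚ)) := by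
      exact_mod_cast hc
    rw [eulerBrace_eq _ _ (by omega), show 2 * (i + t) + 1 - 2 * i = 2 * t + 1 by omega]
    linear_combination -(eulerNum (2 * t + 1)) * hc'
  rw [Finset.sum_congr rfl this, ← Finset.mul_sum]
  linear_combination -((2 * (i + s) + 3).choose (2 * i) : ℚ) * hs

theorem gouldA_eq (m i : ℕ) (h : i ≤ m) :
    gouldA m i = 2 ^ ((m + 3) / 2) * eulerBrace m i := by
  induction m using Nat.strong_induction_on with
  | _ m ih =>
    rcases h.eq_or_lt with rfl | hlt
    · rw [gouldA_self, eulerBrace_self, show (i + 3) / 2 = (i + 1) / 2 + 1 by omega, pow_succ]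
      ring
    · obtain ⟨k, rfl⟩ : ∃ k, m = k + 1 := ⟨m - 1, by omega⟩
      have h1 := gouldA_succ k i (by omega)
      have h2 := two_mul_eulerBrace_succ k i (by omega)
      have h3 : ∀ j ∈ Finset.Icc i k,
          ((2 * k + 3).choose (2 * j + 1) : ℚ) * (2 ^ ((j + 3) / 2))⁻¹ * gouldA j i =
          ((2 * k + 3).choose (2 * j + 1) : ℚ) * eulerBrace j i := by
        intro j hj
        rw [Finset.mem_Icc] at hj
        rw [ih j (by omega) hj.1]
        field_simp
      rw [Finset.sum_congr rfl h3, ← h2, inv_mul_eq_iff_eq_mul₀ (by positivity)] at h1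
      -- The two exponents differ by one, which absorbs the 2 in `2 * eulerBrace (k + 1) i`.
      rw [h1, show (k + 1 + 3) / 2 = (k + 2) / 2 + 1 by omega, pow_succ]
      ring

end Euler

/-! ### Gould's constants `G_i^m` and `Q_i^m` -/

section Gould

theorem gouldG_eq (m i : ℕ) :
    gouldG m i = gouldC m * (2 / (2 * (m : ℚ) + 1) *
      (((2 * m + 1).choose (2 * i + 1) : ℚ) * bernoulli (2 * m - 2 * i))) := by
  have : (2 * (m : ℚ) + 1) ≠ 0 := by positivity
  rw [gouldG, gouldC, Finset.prod_range_succ]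
  field_simp

theorem succ_mul_gouldQ (k i : ℕ) :
    ((k : ℚ) + 1) * gouldQ k i = ((k + 1).choose i : ℚ) * (k + 1 + i) := by
  cases i with
  | zero => simp [gouldQ]
  | succ i =>
    have h1 : ((k : ℚ) + 1) * (k.choose i : ℚ) = ((k + 1).choose (i + 1) : ℚ) * (i + 1) := by
      exact_mod_cast Nat.add_one_mul_choose_eq k i
    have h2 : ((k + 1).choose (i + 1) : ℚ) = k.choose i + k.choose (i + 1) := by
      exact_mod_cast Nat.choose_succ_succ k i
    rw [gouldQ, if_neg (Nat.succ_ne_zero i), Nat.add_sub_cancel]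
    push_cast
    linear_combination -(k + 1 : ℚ) * h2 + h1

theorem choose_mul_choose_eq_gouldQ (m i : ℕ) (hm : 1 ≤ m) (hi : i ≤ m) :
    ((2 * m - 1).choose (m - i) : ℚ) * ((m + i).choose i : ℚ) =
      ((2 * m - 1).factorial : ℚ) / ((m.factorial : ℚ) * ((m - 1).factorial : ℚ)) *
        gouldQ (m - 1) i := by
  obtain ⟨k, rfl⟩ : ∃ k, m = k + 1 := ⟨m - 1, by omega⟩
  have hQ : gouldQ k i = ((k + 1).choose i : ℚ) * (k + 1 + i) / (k + 1) := by
    rw [eq_div_iff (by positivity), ← succ_mul_gouldQ]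
    ring
  rw [show k + 1 - 1 = k by omega, hQ, Nat.cast_choose ℚ (show k + 1 - i ≤ 2 * (k + 1) - 1 by omega),
    Nat.cast_choose ℚ (show i ≤ k + 1 + i by omega), Nat.cast_choose ℚ hi,
    show 2 * (k + 1) - 1 - (k + 1 - i) = k + i by omega, show k + 1 + i - i = k + 1 by omega,
    show k + 1 + i = (k + i) + 1 by omega, Nat.factorial_succ (k + i), Nat.factorial_succ k]
  push_cast
  have := Nat.cast_ne_zero (R := ℚ).mpr (Nat.factorial_ne_zero i)
  have := Nat.cast_ne_zero (R := ℚ).mpr (Nat.factorial_ne_zero k)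
  have := Nat.cast_ne_zero (R := ℚ).mpr (Nat.factorial_ne_zero (k + i))
  have := Nat.cast_ne_zero (R := ℚ).mpr (Nat.factorial_ne_zero (k + 1 - i))
  have : (k : ℚ) + 1 ≠ 0 := by positivity
  field_simp
  ring

/-- The two binomials in `Q_i^k` come from the two terms of `1 - 2X`, the second shifted by one;
hence the top index `k + 1`. -/
theorem sum_gouldQ_mul_X_pow (k : ℕ) :
    ∑ i ∈ Finset.range (k + 2),
      Polynomial.C ((-1) ^ i * gouldQ k i) * (Polynomial.X : Polynomial ℚ) ^ (k + i) =
    Polynomial.X ^ k * (1 - Polynomial.X) ^ k * (1 - 2 * Polynomial.X) := by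
  have hb : (1 - Polynomial.X : Polynomial ℚ) ^ k =
      ∑ i ∈ Finset.range (k + 1), (-1) ^ i * (k.choose i : Polynomial ℚ) * Polynomial.X ^ i := by
    rw [sub_eq_neg_add, add_pow]
    refine Finset.sum_congr rfl fun i _ => ?_
    rw [neg_pow, one_pow]
    ring
  have h1 : ∑ i ∈ Finset.range (k + 2),
      (-1) ^ i * (k.choose i : Polynomial ℚ) * Polynomial.X ^ i = (1 - Polynomial.X) ^ k := by
    rw [Finset.sum_range_succ, ← hb]
    simp
  have h2 : ∑ i ∈ Finset.range (k + 2), (-1) ^ i *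
      (if i = 0 then 0 else (k.choose (i - 1) : Polynomial ℚ)) * Polynomial.X ^ i =
      -Polynomial.X * (1 - Polynomial.X) ^ k := by
    rw [Finset.sum_range_succ', hb, Finset.mul_sum]
    simp only [if_true, mul_zero, zero_mul, add_zero]
    refine Finset.sum_congr rfl fun i _ => ?_
    rw [if_neg (Nat.succ_ne_zero i), Nat.add_sub_cancel]
    ring
  calc _ = Polynomial.X ^ k * (∑ i ∈ Finset.range (k + 2),
        (-1) ^ i * (k.choose i : Polynomial ℚ) * Polynomial.X ^ i +
        2 * ∑ i ∈ Finset.range (k + 2), (-1) ^ i *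
          (if i = 0 then 0 else (k.choose (i - 1) : Polynomial ℚ)) * Polynomial.X ^ i) := by
        rw [Finset.mul_sum, ← Finset.sum_add_distrib, Finset.mul_sum]
        refine Finset.sum_congr rfl fun i _ => ?_
        rw [gouldQ]
        rw [← Polynomial.C_ofNat (R := ℚ) 2]
        split_ifs <;> simp [pow_add] <;> ring
    _ = _ := by
        rw [h1, h2]
        ring

end Gould

/-! ### Three antisymmetric families, three characterizations -/

section Characterizations

variable {K : Type*} [Field K] [CharZero K]

theorem mem_F_one_iff_gouldQ (φ : K⟦X⟧) :
    φ ∈ F K 1 ↔ ∀ m : ℕ, 1 ≤ m → ∑ i ∈ Finset.range (m + 1),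
      (-1 : K) ^ i * (gouldQ (m - 1) i : K) * PowerSeries.coeff (m + i - 1) φ = 0 := by
  have h1 : (1 - Polynomial.X : Polynomial ℚ).natDegree = 1 := by compute_degree!
  have h2 : (1 - 2 * Polynomial.X : Polynomial ℚ).natDegree = 1 := by compute_degree!
  have h1' : (1 - Polynomial.X : Polynomial ℚ) ≠ 0 := fun h => by simp [h] at h1
  have h2' : (1 - 2 * Polynomial.X : Polynomial ℚ) ≠ 0 := fun h => by simp [h] at h2
  have key := mem_F_one_iff_of_rat_family φ (P := fun k =>
    Polynomial.X ^ k * (1 - Polynomial.X) ^ k * (1 - 2 * Polynomial.X)) (fun k => by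
      simp
      ring) (fun k => by
      rw [Polynomial.natDegree_mul (mul_ne_zero (pow_ne_zero _ Polynomial.X_ne_zero)
        (pow_ne_zero _ h1')) h2', Polynomial.natDegree_mul (pow_ne_zero _ Polynomial.X_ne_zero)
        (pow_ne_zero _ h1'), Polynomial.natDegree_pow, Polynomial.natDegree_pow,
        Polynomial.natDegree_X, h1, h2]
      ring)
  have hval : ∀ k, coeffFunctional φ ((Polynomial.X ^ k * (1 - Polynomial.X) ^ k *
      (1 - 2 * Polynomial.X) : Polynomial ℚ).map (algebraMap ℚ K)) =
      ∑ i ∈ Finset.range (k + 2),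
        (-1 : K) ^ i * (gouldQ k i : K) * PowerSeries.coeff (k + i) φ := by
    intro k
    rw [← sum_gouldQ_mul_X_pow, Polynomial.map_sum, map_sum]
    refine Finset.sum_congr rfl fun i _ => ?_
    rw [Polynomial.map_mul, Polynomial.map_C, Polynomial.map_pow, Polynomial.map_X,
      coeffFunctional_C_mul, coeffFunctional_X_pow]
    simp
  rw [key]
  simp only [hval]
  constructor
  · intro h m hm
    obtain ⟨k, rfl⟩ : ∃ k, m = k + 1 := ⟨m - 1, by omega⟩
    rw [← h k]
    exact Finset.sum_congr rfl fun i _ => by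
      rw [show k + 1 - 1 = k by omega, show k + 1 + i - 1 = k + i by omega]
  · intro h k
    rw [← h (k + 1) (by omega)]
    exact Finset.sum_congr rfl fun i _ => by
      rw [show k + 1 - 1 = k by omega, show k + 1 + i - 1 = k + i by omega]

theorem mem_F_one_iff_choose (φ : K⟦X⟧) :
    φ ∈ F K 1 ↔ ∀ m : ℕ, 1 ≤ m → ∑ i ∈ Finset.range (m + 1),
      (-1 : K) ^ i * ((2 * m - 1).choose (m - i) : K) * ((m + i).choose i : K) *
        PowerSeries.coeff (m + i - 1) φ = 0 := by
  rw [mem_F_one_iff_gouldQ]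
  refine forall₂_congr fun m hm => ?_
  set c : ℚ := ((2 * m - 1).factorial : ℚ) / ((m.factorial : ℚ) * ((m - 1).factorial : ℚ)) with hc
  have hc0 : (c : K) ≠ 0 := by
    rw [Rat.cast_ne_zero, hc]
    positivity
  have : ∑ i ∈ Finset.range (m + 1),
      (-1 : K) ^ i * ((2 * m - 1).choose (m - i) : K) * ((m + i).choose i : K) *
        PowerSeries.coeff (m + i - 1) φ = (c : K) * ∑ i ∈ Finset.range (m + 1),
      (-1 : K) ^ i * (gouldQ (m - 1) i : K) * PowerSeries.coeff (m + i - 1) φ := by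
    rw [Finset.mul_sum]
    refine Finset.sum_congr rfl fun i hi => ?_
    have h := congrArg (Rat.cast (K := K)) (choose_mul_choose_eq_gouldQ m i hm
      (Nat.lt_succ_iff.mp (Finset.mem_range.mp hi)))
    rw [← hc, Rat.cast_mul, Rat.cast_mul, Rat.cast_natCast, Rat.cast_natCast] at h
    linear_combination (-1) ^ i * PowerSeries.coeff (m + i - 1) φ * h
  rw [this, mul_eq_zero, or_iff_right hc0]

/-- The only nonzero coefficient of odd index in `E_{2m+1}` is the leading 1, so `L(E_{2m+1}) = 0`
solves for `γ_{2m+1}`. -/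
theorem mem_F_one_iff_eulerBrace (φ : K⟦X⟧) :
    φ ∈ F K 1 ↔ ∀ m : ℕ, PowerSeries.coeff (2 * m + 1) φ =
      ∑ i ∈ Finset.range (m + 1), (eulerBrace m i : K) * PowerSeries.coeff (2 * i) φ := by
  rw [mem_F_one_iff_of_rat_family φ (P := fun m => eulerPoly (2 * m + 1))
    (fun m => by rw [eulerPoly_comp_one_sub_X, (odd_two_mul_add_one m).neg_one_pow, neg_one_mul])
    (fun m => natDegree_eulerPoly _)]
  refine forall_congr' fun m => ?_
  rw [coeffFunctional_map φ (eulerPoly (2 * m + 1)) (N := 2 * (m + 1))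
    (by rw [natDegree_eulerPoly]; omega), sum_range_two_mul, Finset.sum_add_distrib,
    Finset.sum_eq_single_of_mem (f := fun i =>
      ((eulerPoly (2 * m + 1)).coeff (2 * i + 1) : K) * PowerSeries.coeff (2 * i + 1) φ) m
      (by simp) (fun i hi him => by
        rw [coeff_eulerPoly_odd m i (Nat.lt_succ_iff.mp (Finset.mem_range.mp hi)), if_neg him]
        simp), coeff_eulerPoly_odd m m le_rfl, if_pos rfl, Rat.cast_one, one_mul]
  simp only [coeff_eulerPoly_even, Rat.cast_neg, neg_mul, Finset.sum_neg_distrib]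
  rw [neg_add_eq_zero, eq_comm]

theorem coeff_bernoulli_even (m i : ℕ) (h : i ≤ m) :
    (Polynomial.bernoulli (2 * m + 1)).coeff (2 * i) =
      if i = m then -(2 * (m : ℚ) + 1) / 2 else 0 := by
  rw [Polynomial.coeff_bernoulli, if_pos (by omega)]
  split_ifs with hi
  · rw [hi, show 2 * m + 1 - 2 * m = 1 by omega, bernoulli_one, Nat.choose_succ_self_right]
    push_cast
    ring
  · rw [bernoulli_eq_zero_of_odd (by rw [Nat.odd_iff]; omega) (by omega), zero_mul]

theorem natDegree_bernoulli (n : ℕ) : (Polynomial.bernoulli n).natDegree = n := by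
  refine Polynomial.natDegree_eq_of_le_of_coeff_ne_zero ?_ (n := n) ?_
  · rw [Polynomial.natDegree_le_iff_coeff_eq_zero]
    intro j hj
    rw [Polynomial.coeff_bernoulli, if_neg (by omega)]
  · simp [Polynomial.coeff_bernoulli]

/-- The only nonzero coefficient of even index in `B_{2m+1}(X)` is `(2m+1) B_1 = -(2m+1)/2` at
`X^{2m}`, so `L(B_{2m+1}) = 0` solves for `γ_{2m}`. -/
theorem mem_F_one_iff_bernoulli (φ : K⟦X⟧) :
    φ ∈ F K 1 ↔ ∀ m : ℕ, PowerSeries.coeff (2 * m) φ =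
      2 / (2 * (m : K) + 1) * ∑ i ∈ Finset.range (m + 1),
        ((2 * m + 1).choose (2 * i + 1) : K) * (bernoulli (2 * m - 2 * i) : K) *
          PowerSeries.coeff (2 * i + 1) φ := by
  rw [mem_F_one_iff_of_rat_family φ (P := fun m => Polynomial.bernoulli (2 * m + 1))
    (fun m => by
      rw [Polynomial.bernoulli_comp_one_sub_X, (odd_two_mul_add_one m).neg_one_pow, neg_one_mul])
    (fun m => natDegree_bernoulli _)]
  refine forall_congr' fun m => ?_
  have hm : (2 * (m : K) + 1) ≠ 0 := by exact_mod_cast Nat.succ_ne_zero (2 * m)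
  have hodd : ∀ i ∈ Finset.range (m + 1),
      ((Polynomial.bernoulli (2 * m + 1)).coeff (2 * i + 1) : K) *
        PowerSeries.coeff (2 * i + 1) φ =
      ((2 * m + 1).choose (2 * i + 1) : K) * (bernoulli (2 * m - 2 * i) : K) *
        PowerSeries.coeff (2 * i + 1) φ := by
    intro i hi
    have hi' := Finset.mem_range.mp hi
    rw [Polynomial.coeff_bernoulli, if_pos (by omega),
      show 2 * m + 1 - (2 * i + 1) = 2 * m - 2 * i by omega, Rat.cast_mul, Rat.cast_natCast]
    ring
  rw [coeffFunctional_map φ (Polynomial.bernoulli (2 * m + 1)) (N := 2 * (m + 1))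
    (by rw [natDegree_bernoulli]; omega), sum_range_two_mul, Finset.sum_add_distrib,
    Finset.sum_congr rfl hodd, Finset.sum_eq_single_of_mem (f := fun i =>
      ((Polynomial.bernoulli (2 * m + 1)).coeff (2 * i) : K) * PowerSeries.coeff (2 * i) φ) m
      (by simp) (fun i hi him => by
        rw [coeff_bernoulli_even m i (Nat.lt_succ_iff.mp (Finset.mem_range.mp hi)), if_neg him]
        simp), coeff_bernoulli_even m m le_rfl, if_pos rfl]
  push_cast
  rw [div_mul_eq_mul_div _ (2 * (m : K) + 1), eq_div_iff hm]
  constructor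
  · intro h
    linear_combination (-2) * h
  · intro h
    linear_combination (-1 / 2) * h

end Characterizations

/-! ### Gould's forms of the power sum identities -/

section Identities

variable {K : Type*} [Field K] [CharZero K]

theorem coeff_powerSumSeries {K : Type*} [Field K] (f : ℕ → ℕ → K) (n p : ℕ) :
    PowerSeries.coeff p (powerSumSeries f n) = powerSum f n p := by
  rw [powerSumSeries, PowerSeries.coeff_mk]

theorem pow_mul_powerSum (f : ℕ → ℕ → K) {n : ℕ} (hn : 1 ≤ n) (p : ℕ) :
    (n : K) ^ p * powerSum f n p = ∑ k ∈ Finset.range (n + 1), (k : K) ^ p * f n k := by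
  have hn0 : (n : K) ≠ 0 := Nat.cast_ne_zero.mpr (by omega)
  rw [powerSum, mul_inv_cancel_left₀ (pow_ne_zero _ hn0)]

theorem sum_gouldQ_mul_sum_eq_zero {f : ℕ → ℕ → K} {n : ℕ} (hn : 1 ≤ n)
    (hF : powerSumSeries f n ∈ F K 1) {m : ℕ} (hm : 1 ≤ m) :
    ∑ i ∈ Finset.range (m + 1), (-1 : K) ^ i * (gouldQ (m - 1) i : K) * (n : K) ^ (m - i) *
      ∑ k ∈ Finset.range (n + 1), (k : K) ^ (m + i - 1) * f n k = 0 := by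
  have h := (mem_F_one_iff_gouldQ _).mp hF m hm
  -- The power `n^{2m-1} = n^{m-i} n^{m+i-1}` clears the normalization of every `S_{n,m+i-1}` at
  -- once.
  calc _ = (n : K) ^ (2 * m - 1) * ∑ i ∈ Finset.range (m + 1), (-1 : K) ^ i *
        (gouldQ (m - 1) i : K) * PowerSeries.coeff (m + i - 1) (powerSumSeries f n) := by
        rw [Finset.mul_sum]
        refine Finset.sum_congr rfl fun i hi => ?_
        have hi' := Finset.mem_range.mp hi
        rw [← pow_mul_powerSum f hn, coeff_powerSumSeries,
          show 2 * m - 1 = (m - i) + (m + i - 1) by omega, pow_add]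
        ring
    _ = 0 := by rw [h, mul_zero]

theorem two_pow_mul_powerSum_odd {f : ℕ → ℕ → K} {n : ℕ}
    (hF : powerSumSeries f n ∈ F K 1) (m : ℕ) :
    (2 : K) ^ ((m + 3) / 2) * powerSum f n (2 * m + 1) =
      ∑ i ∈ Finset.range (m + 1), (gouldA m i : K) * powerSum f n (2 * i) := by
  have h := (mem_F_one_iff_eulerBrace _).mp hF m
  simp only [coeff_powerSumSeries] at h
  rw [h, Finset.mul_sum]
  refine Finset.sum_congr rfl fun i hi => ?_
  rw [gouldA_eq m i (Nat.lt_succ_iff.mp (Finset.mem_range.mp hi))]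
  push_cast
  ring

theorem gouldC_mul_powerSum_even {f : ℕ → ℕ → K} {n : ℕ}
    (hF : powerSumSeries f n ∈ F K 1) (m : ℕ) :
    (gouldC m : K) * powerSum f n (2 * m) =
      ∑ i ∈ Finset.range (m + 1), (gouldG m i : K) * powerSum f n (2 * i + 1) := by
  have h := (mem_F_one_iff_bernoulli _).mp hF m
  simp only [coeff_powerSumSeries] at h
  rw [h, Finset.mul_sum, Finset.mul_sum]
  refine Finset.sum_congr rfl fun i _ => ?_
  rw [gouldG_eq m i]
  push_cast
  ring

end Identities

end PowerSums

theorem mainTheorem7 (K : Type*) [Field K] [CharZero K] :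
    -- For every symmetric triangular array `f`, each `φ_n` lies in `F_1`, ...
    (∀ f : ℕ → ℕ → K, (∀ n k : ℕ, k ≤ n → f n k = f n (n - k)) →
      ∀ n : ℕ, 1 ≤ n →
        PowerSums.powerSumSeries f n ∈ PowerSums.F K 1 ∧
        -- ... and the power sum identities hold: first family, ...
        (∀ m : ℕ, 1 ≤ m →
          ∑ i ∈ Finset.range (m + 1),
            (-1 : K) ^ i * ((2 * m - 1).choose (m - i) : K) * ((m + i).choose i : K) *
              PowerSums.powerSum f n (m + i - 1) = 0) ∧
        (∀ m : ℕ, 1 ≤ m →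
          ∑ i ∈ Finset.range (m + 1),
            (-1 : K) ^ i * (PowerSums.gouldQ (m - 1) i : K) * (n : K) ^ (m - i) *
              ∑ k ∈ Finset.range (n + 1), (k : K) ^ (m + i - 1) * f n k = 0) ∧
        -- ... second family, ...
        (∀ m : ℕ, PowerSums.powerSum f n (2 * m + 1) =
          ∑ i ∈ Finset.range (m + 1),
            (PowerSums.eulerBrace m i : K) * PowerSums.powerSum f n (2 * i)) ∧
        (∀ m : ℕ, (2 : K) ^ ((m + 3) / 2) * PowerSums.powerSum f n (2 * m + 1) =
          ∑ i ∈ Finset.range (m + 1),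
            (PowerSums.gouldA m i : K) * PowerSums.powerSum f n (2 * i)) ∧
        -- ... third family.
        (∀ m : ℕ, PowerSums.powerSum f n (2 * m) =
          2 / (2 * (m : K) + 1) * ∑ i ∈ Finset.range (m + 1),
            ((2 * m + 1).choose (2 * i + 1) : K) * (bernoulli (2 * m - 2 * i) : K) *
              PowerSums.powerSum f n (2 * i + 1)) ∧
        (∀ m : ℕ, (PowerSums.gouldC m : K) * PowerSums.powerSum f n (2 * m) =
          ∑ i ∈ Finset.range (m + 1),
            (PowerSums.gouldG m i : K) * PowerSums.powerSum f n (2 * i + 1))) ∧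
    -- Each family is an instance of a characterization of all members of `F_1`, ...
    (∀ φ : PowerSeries K,
      (φ ∈ PowerSums.F K 1 ↔ ∀ m : ℕ, 1 ≤ m →
        ∑ i ∈ Finset.range (m + 1),
          (-1 : K) ^ i * ((2 * m - 1).choose (m - i) : K) * ((m + i).choose i : K) *
            PowerSeries.coeff (m + i - 1) φ = 0) ∧
      (φ ∈ PowerSums.F K 1 ↔ ∀ m : ℕ, PowerSeries.coeff (2 * m + 1) φ =
        ∑ i ∈ Finset.range (m + 1),
          (PowerSums.eulerBrace m i : K) * PowerSeries.coeff (2 * i) φ) ∧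
      (φ ∈ PowerSums.F K 1 ↔ ∀ m : ℕ, PowerSeries.coeff (2 * m) φ =
        2 / (2 * (m : K) + 1) * ∑ i ∈ Finset.range (m + 1),
          ((2 * m + 1).choose (2 * i + 1) : K) * (bernoulli (2 * m - 2 * i) : K) *
            PowerSeries.coeff (2 * i + 1) φ)) ∧
    -- ... and the two forms of each family differ by a constant factor.
    (∀ m i : ℕ, 1 ≤ m → i ≤ m →
      ((2 * m - 1).choose (m - i) : ℚ) * ((m + i).choose i : ℚ) =
        ((2 * m - 1).factorial : ℚ) / ((m.factorial : ℚ) * ((m - 1).factorial : ℚ)) *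
          PowerSums.gouldQ (m - 1) i) ∧
    (∀ m i : ℕ, i ≤ m →
      PowerSums.gouldA m i = 2 ^ ((m + 3) / 2) * PowerSums.eulerBrace m i) ∧
    (∀ m i : ℕ, i ≤ m →
      PowerSums.gouldG m i = PowerSums.gouldC m * (2 / (2 * (m : ℚ) + 1) *
        (((2 * m + 1).choose (2 * i + 1) : ℚ) * bernoulli (2 * m - 2 * i)))) := by
  refine ⟨fun f hf n hn => ?_, fun φ => ⟨PowerSums.mem_F_one_iff_choose φ,
    PowerSums.mem_F_one_iff_eulerBrace φ, PowerSums.mem_F_one_iff_bernoulli φ⟩,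
    PowerSums.choose_mul_choose_eq_gouldQ, PowerSums.gouldA_eq,
    fun m i _ => PowerSums.gouldG_eq m i⟩
  have hF := PowerSums.powerSumSeries_mem_F_one hf hn
  refine ⟨hF, fun m hm => ?_, fun m hm => PowerSums.sum_gouldQ_mul_sum_eq_zero hn hF hm,
    fun m => ?_, PowerSums.two_pow_mul_powerSum_odd hF, fun m => ?_,
    PowerSums.gouldC_mul_powerSum_even hF⟩
  · simpa only [PowerSums.coeff_powerSumSeries] using
      (PowerSums.mem_F_one_iff_choose _).mp hF m hm
  · simpa only [PowerSums.coeff_powerSumSeries] using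
      (PowerSums.mem_F_one_iff_eulerBrace _).mp hF m
  · simpa only [PowerSums.coeff_powerSumSeries] using
      (PowerSums.mem_F_one_iff_bernoulli _).mp hF m
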